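/- Let $X$ be a nonempty compact metric space, let $\mathcal{K}(X)$ be the set of nonempty compact subsets of $X$ with the Hausdorff metric, and equip $\mathcal{K}(X)\times(0,1)$ with the product topology. For $E\subseteq X$ and $r>0$ let $N(E,r)$ be the minimal number of open balls of radius $r$ in $X$ needed to cover $E$, and let $B(x,R)$ be the closed ball with centre $x$ and radius $R$. For $F\in\mathcal{K}(X)$ and $\theta\in(0,1)$ the lower spectrum is $$\dim_{\mathrm L}^\theta F=\sup\Big\{\alpha\in\mathbb{R}:\ (\exists C>0)(\exists \rho>0)(\forall\, 0<R\le\rho)(\forall x\in F)\ \ N\big(B(x,R)\cap F,R^{1/\theta}\big)\ge C\Big(\frac{R}{R^{1/\theta}}\Big)^{\alpha}\Big\}\in[0,\infty].$$ A function between topological spaces is of Baire class $0$ if it is continuous, and of Baire class $n+1$ if it is a pointwise limit of a sequence of functions of Baire class $n$. **Theorem.** For every nonempty compact metric space $X$, the function $\Delta_{\mathrm L}(F,\theta)=\dim_{\mathrm L}^\theta F$ on $\mathcal{K}(X)\times(0,1)$ is of Baire class $2$ and, in particular, Borel measurable, as a function with values in the extended real line; if all its values are finite, it is also of Baire class $2$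 as a function with values in $\mathbb{R}$. In general it is not of Baire class $1$: for $X=[0,1]$ all its values are finite, and it is not of Baire class $1$, neither as an extended-real-valued nor as a real-valued function. -/

import Mathlib

open Filter Topology Metric TopologicalSpace

noncomputable section

/-- Baire classes of functions between topological spaces: class `0` consists of the continuous
functions, and class `n + 1` of the pointwise limits of sequences of functions of class `n`. -/
def IsBaireClass {A B : Type*} [TopologicalSpace A] [TopologicalSpace B] :
    ℕ → (A → B) → Prop
  | 0, f => Continuous f
  | n + 1, f => ∃ g : ℕ → A → B, (∀ k, IsBaireClass n (g k)) ∧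
      ∀ a, Tendsto (fun k => g k a) atTop (𝓝 (f a))

/-- `coverNumber E r` is the minimal number of open balls of radius `r` of the ambient space `X`
that are needed to cover `E`. A finite cover exists for all `E` and `r > 0` when `X` is compact
(see `exists_cover_card_eq_coverNumber`). -/
def coverNumber {X : Type*} [MetricSpace X] (E : Set X) (r : ℝ) : ℕ :=
  sInf {n : ℕ | ∃ t : Finset X, t.card = n ∧ E ⊆ ⋃ c ∈ t, ball c r}

/-- In a compact space the minimum that defines the covering number is taken over a nonempty set,
hence attained. -/
theorem exists_cover_card_eq_coverNumber {X : Type*} [MetricSpace X] [CompactSpace X]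
    (E : Set X) {r : ℝ} (hr : 0 < r) :
    ∃ t : Finset X, t.card = coverNumber E r ∧ E ⊆ ⋃ c ∈ t, ball c r := by
  refine Nat.sInf_mem (s := {n : ℕ | ∃ t : Finset X, t.card = n ∧ E ⊆ ⋃ c ∈ t, ball c r}) ?_
  obtain ⟨t, ht, hcov⟩ :=
    totallyBounded_iff.1 (isCompact_univ (X := X)).totallyBounded r hr
  exact ⟨_, ht.toFinset, rfl, fun x _ => by simpa using hcov (Set.mem_univ x)⟩

/-- The exponents admissible in the definition of the lower spectrum: those real `α` for which
there are `C > 0` and `ρ > 0` such that, for all `0 < R ≤ ρ` and all `x ∈ F`, at least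
`C (R / R ^ (1 / θ)) ^ α` balls of radius `R ^ (1 / θ)` are needed to cover `B(x, R) ∩ F`. -/
def lowerSpectrumExponents {X : Type*} [MetricSpace X] (F : Set X) (θ : ℝ) : Set ℝ :=
  {α : ℝ | ∃ C : ℝ, 0 < C ∧ ∃ ρ : ℝ, 0 < ρ ∧ ∀ R : ℝ, 0 < R → R ≤ ρ → ∀ x ∈ F,
    C * (R / R ^ (1 / θ)) ^ α ≤ (coverNumber (closedBall x R ∩ F) (R ^ (1 / θ)) : ℝ)}

/-- The lower spectrum `dim_L^θ F` (for `0 < θ < 1`), the supremum of the admissible exponents.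
It is an extended real number, since it is `⊤` for some compact `F`. -/
def lowerSpectrum {X : Type*} [MetricSpace X] (F : Set X) (θ : ℝ) : EReal :=
  sSup ((fun α : ℝ => (α : EReal)) '' lowerSpectrumExponents F θ)

/-- The map `(F, θ) ↦ dim_L^θ F` on `𝒦(X) × (0, 1)`. Here `𝒦(X) = NonemptyCompacts X` carries
Mathlib's topology, which is that of the Hausdorff metric. -/
def lowerSpectrumMap (X : Type*) [MetricSpace X]
    (p : NonemptyCompacts X × Set.Ioo (0 : ℝ) 1) : EReal :=
  lowerSpectrum (p.1 : Set X) (p.2 : ℝ)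

end

/-!
Requiring the covering bound with constant `C = 1` at all scales up to a fixed `ρ` is a closed
condition on `(F, θ)`, because a finite open cover of a compact set also covers all nearby compact
sets. The largest exponent in `[0, n]` that meets it for `ρ = 1 / (n + 1)` is therefore a bounded
upper semicontinuous function, hence of Baire class `1`, being the limit of its Lipschitz
sup-convolutions. As `n → ∞` these functions converge to the lower spectrum, since lowering the
exponent slightly absorbs any constant `C`.

A function of Baire class `1` on a Baire space cannot lie below `c` on one dense set and above
`d > c` on another. For fixed `θ`, the lower spectrum vanishes on finite sets. It is at least `1` on
finite unions of nondegenerate continua, since the distance to a point maps a continuum onto an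
interval. When every point has arbitrarily small continua nearby, both families are dense.
-/

open Asymptotics

section BaireClass

variable {A B C : Type*} [TopologicalSpace A] [TopologicalSpace B] [TopologicalSpace C]

theorem IsBaireClass.continuous_comp {φ : B → C} (hφ : Continuous φ) :
    ∀ {n : ℕ} {f : A → B}, IsBaireClass n f → IsBaireClass n fun a => φ (f a)
  | 0, _, hf => hφ.comp hf
  | _ + 1, _, ⟨g, hg, hlim⟩ => ⟨fun k a => φ (g k a), fun k => (hg k).continuous_comp hφ,
      fun a => (hφ.tendsto _).comp (hlim a)⟩

theorem IsBaireClass.comp_continuous {φ : C → A} (hφ : Continuous φ) :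
    ∀ {n : ℕ} {f : A → B}, IsBaireClass n f → IsBaireClass n fun c => f (φ c)
  | 0, _, hf => Continuous.comp hf hφ
  | _ + 1, _, ⟨g, hg, hlim⟩ => ⟨fun k c => g k (φ c), fun k => (hg k).comp_continuous hφ,
      fun c => hlim (φ c)⟩

theorem IsBaireClass.measurable [MeasurableSpace A] [BorelSpace A] [PseudoMetrizableSpace B]
    [MeasurableSpace B] [BorelSpace B] :
    ∀ {n : ℕ} {f : A → B}, IsBaireClass n f → Measurable f
  | 0, _, hf => Continuous.measurable hf
  | _ + 1, _, ⟨_, hg, hlim⟩ =>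
      measurable_of_tendsto_metrizable (fun k => (hg k).measurable) (tendsto_pi_nhds.2 hlim)

theorem IsBaireClass.eventually_residual_le_of_dense [LinearOrder B] [OrderTopology B]
    {f : A → B} {c : B} (hf : IsBaireClass 1 f) (hc : Dense {a | f a < c}) :
    ∀ᶠ a in residual A, f a ≤ c := by
  obtain ⟨g, hg, hlim⟩ := hf
  have hG : IsGδ (⋂ n, ⋃ k ≥ n, {a | g k a < c}) := .iInter_of_isOpen fun n =>
    isOpen_biUnion fun k _ => isOpen_lt (show Continuous (g k) from hg k) continuous_const
  have hsub : {a | f a < c} ⊆ ⋂ n, ⋃ k ≥ n, {a | g k a < c} := fun a ha =>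
    Set.mem_iInter.2 fun n => Set.mem_iUnion₂.2 <| by
      simpa using ((eventually_ge_atTop n).and ((hlim a).eventually (gt_mem_nhds ha))).exists
  filter_upwards [residual_of_dense_Gδ hG (hc.mono hsub)] with a ha
  refine le_of_tendsto_of_frequently (hlim a) (frequently_atTop.2 fun n => ?_)
  obtain ⟨k, hk, hkc⟩ := Set.mem_iUnion₂.1 (Set.mem_iInter.1 ha n)
  exact ⟨k, hk, hkc.le⟩

theorem not_isBaireClass_one_of_dense [BaireSpace A] [Nonempty A] [LinearOrder B]
    [OrderTopology B] {f : A → B} {c d : B} (hcd : c < d) (hc : Dense {a | f a < c})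
    (hd : Dense {a | d < f a}) : ¬ IsBaireClass 1 f := fun hf => by
  have hle : ∀ᶠ a in residual A, f a ≤ c := hf.eventually_residual_le_of_dense hc
  have hge : ∀ᶠ a in residual A, d ≤ f a :=
    (hf.continuous_comp continuous_toDual).eventually_residual_le_of_dense
      (c := OrderDual.toDual d) hd
  obtain ⟨a, hac, hda⟩ := (dense_of_mem_residual (hle.and hge)).nonempty
  exact (hcd.trans_le hda).not_ge hac

end BaireClass

section SupConvolution

variable {A : Type*} [PseudoMetricSpace A] {g : A → ℝ}

/-- The Lipschitz sup-convolution `x ↦ sup_y (g y - k d(x, y))` of `g`. For `g` bounded above it is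
the least `k`-Lipschitz majorant of `g`. -/
noncomputable def supConvolution (g : A → ℝ) (k : ℕ) (x : A) : ℝ :=
  ⨆ y, (g y - k * dist x y)

theorem bddAbove_range_sub_mul_dist (hg : BddAbove (Set.range g)) (k : ℕ) (x : A) :
    BddAbove (Set.range fun y => g y - k * dist x y) := by
  refine hg.range_mono _ fun y => sub_le_self _ (by positivity)

theorem le_supConvolution (hg : BddAbove (Set.range g)) (k : ℕ) (x : A) :
    g x ≤ supConvolution g k x := by
  simpa [supConvolution] using le_ciSup (bddAbove_range_sub_mul_dist hg k x) x

theorem lipschitzWith_supConvolution (hg : BddAbove (Set.range g)) (k : ℕ) :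
    LipschitzWith k (supConvolution g k) := by
  refine .of_le_add_mul _ fun x y => ?_
  have : Nonempty A := ⟨x⟩
  refine ciSup_le fun z => ?_
  have hz : g z - k * dist y z ≤ supConvolution g k y :=
    le_ciSup (bddAbove_range_sub_mul_dist hg k y) z
  have htri : (k : ℝ) * dist y z ≤ k * (dist x y + dist x z) := by
    gcongr
    exact dist_triangle_left y z x
  rw [NNReal.coe_natCast]
  linarith

theorem tendsto_supConvolution (hg : BddAbove (Set.range g)) {a : A}
    (ha : UpperSemicontinuousAt g a) :
    Tendsto (fun k => supConvolution g k a) atTop (𝓝 (g a)) := by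
  refine tendsto_order.2 ⟨fun c hc => .of_forall fun k => hc.trans_le (le_supConvolution hg k a),
    fun c hc => ?_⟩
  obtain ⟨M, hM⟩ := hg
  obtain ⟨c', hac', hc'c⟩ := exists_between hc
  obtain ⟨δ, hδ, hball⟩ := Metric.eventually_nhds_iff.1 (ha c' hac')
  have hlarge : ∀ᶠ k : ℕ in atTop, M - c' ≤ k * δ :=
    (tendsto_natCast_atTop_atTop.atTop_mul_const hδ).eventually_ge_atTop _
  filter_upwards [hlarge] with k hk
  have : Nonempty A := ⟨a⟩
  refine (ciSup_le fun y => ?_).trans_lt hc'c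
  rcases lt_or_ge (dist y a) δ with hy | hy
  · exact (sub_le_self _ (by positivity)).trans (hball hy).le
  · have hfar : (k : ℝ) * δ ≤ k * dist a y := by
      rw [dist_comm]
      gcongr
    linarith [hM ⟨y, rfl⟩]

theorem isBaireClass_one_of_upperSemicontinuous (hg : UpperSemicontinuous g)
    (hbdd : BddAbove (Set.range g)) : IsBaireClass 1 g :=
  ⟨supConvolution g, fun k => (lipschitzWith_supConvolution hbdd k).continuous,
    fun a => tendsto_supConvolution hbdd (hg a)⟩

end SupConvolution

section NonemptyCompacts

theorem eventually_forall_mem_nonemptyCompacts {X Z : Type*} [TopologicalSpace X]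
    [TopologicalSpace Z] {p : X → Z → Prop} {F₀ : NonemptyCompacts X} {z₀ : Z}
    (h : ∀ x ∈ F₀, ∀ᶠ q : X × Z in 𝓝 (x, z₀), p q.1 q.2) :
    ∀ᶠ q : NonemptyCompacts X × Z in 𝓝 (F₀, z₀), ∀ x ∈ q.1, p x q.2 := by
  have htube : ∀ᶠ q : X × Z in 𝓝ˢ (F₀ : Set X) ×ˢ 𝓝 z₀, p q.1 q.2 :=
    F₀.isCompact.mem_nhdsSet_prod_of_forall fun x hx => by
      rw [← nhds_prod_eq]
      exact h x hx
  obtain ⟨P, hP, Q, hQ, hPQ⟩ := eventually_prod_iff.1 htube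
  obtain ⟨U, hUo, hFU, hU⟩ := eventually_nhdsSet_iff_exists.1 hP
  have hsub : ∀ᶠ F : NonemptyCompacts X in 𝓝 F₀, (F : Set X) ⊆ U :=
    (NonemptyCompacts.isOpen_subsets_of_isOpen hUo).mem_nhds hFU
  filter_upwards [hsub.prod_nhds hQ] with q hq x hx
  exact hPQ (hU x (hq.1 hx)) hq.2

theorem eventually_exists_mem_nonemptyCompacts {X Z : Type*} [TopologicalSpace X]
    [TopologicalSpace Z] {p : NonemptyCompacts X → X → Z → Prop} {F₀ : NonemptyCompacts X} {x₀ : X}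
    {z₀ : Z} (hx₀ : x₀ ∈ F₀)
    (h : ∀ᶠ q : NonemptyCompacts X × X × Z in 𝓝 (F₀, x₀, z₀), p q.1 q.2.1 q.2.2) :
    ∀ᶠ q : NonemptyCompacts X × Z in 𝓝 (F₀, z₀), ∃ x ∈ q.1, p q.1 x q.2 := by
  rw [nhds_prod_eq, nhds_prod_eq] at h
  obtain ⟨P, hP, S, hS, hPS⟩ := eventually_prod_iff.1 h
  obtain ⟨Q, hQ, T, hT, hQT⟩ := eventually_prod_iff.1 hS
  obtain ⟨U, hU, hUo, hxU⟩ := eventually_nhds_iff.1 hQ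
  have hmeet : ∀ᶠ F : NonemptyCompacts X in 𝓝 F₀, ((F : Set X) ∩ U).Nonempty :=
    (NonemptyCompacts.isOpen_inter_nonempty_of_isOpen hUo).mem_nhds ⟨x₀, hx₀, hxU⟩
  filter_upwards [(hP.and hmeet).prod_nhds hT] with q hq
  obtain ⟨⟨hqP, x, hxF, hxU⟩, hqT⟩ := hq
  exact ⟨x, hxF, hPS hqP (hQT (hU x hxU) hqT)⟩

theorem dense_of_supClosed_of_singleton_mem_closure {X : Type*} [TopologicalSpace X]
    {D : Set (NonemptyCompacts X)} (hD : SupClosed D) (h : ∀ x : X, {x} ∈ closure D) :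
    Dense D := by
  have hclosure : SupClosed (closure D) := fun K hK L hL =>
    map_mem_closure₂ continuous_sup hK hL fun _ hK' _ hL' => hD hK' hL'
  refine dense_closure.1 (NonemptyCompacts.dense_setOfPred_finite.mono fun K hK => ?_)
  have hne : hK.toFinset.Nonempty := hK.toFinset_nonempty.2 K.nonempty
  have hsup : hK.toFinset.sup' hne ({·}) = K := by
    refine le_antisymm (Finset.sup'_le _ _ fun x hx => ?_) fun x hx => ?_
    · exact Set.singleton_subset_iff.2 (hK.mem_toFinset.1 hx)
    · exact Finset.le_sup' (f := ({·} : X → NonemptyCompacts X)) (hK.mem_toFinset.2 hx) rfl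
  exact hsup ▸ hclosure.finsetSup'_mem hne fun x _ => h x

end NonemptyCompacts

section CoverNumber

variable {X : Type*} [MetricSpace X] {E F : Set X} {r : ℝ}

theorem coverNumber_le_card {t : Finset X} (h : E ⊆ ⋃ c ∈ t, ball c r) :
    coverNumber E r ≤ t.card :=
  Nat.sInf_le ⟨t, rfl, h⟩

theorem exists_card_eq_coverNumber_of_totallyBounded (hE : TotallyBounded E) (hr : 0 < r) :
    ∃ t : Finset X, t.card = coverNumber E r ∧ E ⊆ ⋃ c ∈ t, ball c r := by
  refine Nat.sInf_mem (s := {n : ℕ | ∃ t : Finset X, t.card = n ∧ E ⊆ ⋃ c ∈ t, ball c r}) ?_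
  obtain ⟨t, ht, hcov⟩ := totallyBounded_iff.1 hE r hr
  exact ⟨_, ht.toFinset, rfl, by simpa only [ht.mem_toFinset] using hcov⟩

theorem coverNumber_mono (hF : TotallyBounded F) (hEF : E ⊆ F) (hr : 0 < r) :
    coverNumber E r ≤ coverNumber F r := by
  obtain ⟨t, ht, hcov⟩ := exists_card_eq_coverNumber_of_totallyBounded hF hr
  exact ht ▸ coverNumber_le_card (hEF.trans hcov)

theorem one_le_coverNumber (hE : TotallyBounded E) (hne : E.Nonempty) (hr : 0 < r) :
    1 ≤ coverNumber E r := by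
  obtain ⟨t, ht, hcov⟩ := exists_card_eq_coverNumber_of_totallyBounded hE hr
  obtain ⟨x, hx⟩ := hne
  obtain ⟨c, hc, -⟩ := Set.mem_iUnion₂.1 (hcov hx)
  exact ht ▸ Finset.card_pos.2 ⟨c, hc⟩

theorem volume_image_le_coverNumber_mul {f : X → ℝ} (hf : LipschitzWith 1 f)
    (hE : TotallyBounded E) (hr : 0 < r) :
    MeasureTheory.volume (f '' E) ≤ coverNumber E r * ENNReal.ofReal (2 * r) := by
  obtain ⟨t, ht, hcov⟩ := exists_card_eq_coverNumber_of_totallyBounded hE hr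
  have hsub : f '' E ⊆ ⋃ c ∈ t, ball (f c) r := by
    rintro _ ⟨x, hx, rfl⟩
    obtain ⟨c, hc, hxc⟩ := Set.mem_iUnion₂.1 (hcov hx)
    exact Set.mem_iUnion₂.2 ⟨c, hc, by simpa using hf.mapsTo_ball one_ne_zero c r hxc⟩
  calc MeasureTheory.volume (f '' E)
      ≤ MeasureTheory.volume (⋃ c ∈ t, ball (f c) r) := MeasureTheory.measure_mono hsub
    _ ≤ ∑ c ∈ t, MeasureTheory.volume (ball (f c) r) :=
        MeasureTheory.measure_biUnion_finset_le _ _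
    _ = coverNumber E r * ENNReal.ofReal (2 * r) := by
        simp only [Real.volume_ball, Finset.sum_const, ht, nsmul_eq_mul]

theorem upperSemicontinuousAt_coverNumber (F₀ : NonemptyCompacts X) (x₀ : X) (R : ℝ)
    (hr : 0 < r) :
    UpperSemicontinuousAt (fun q : NonemptyCompacts X × X × ℝ =>
      coverNumber (closedBall q.2.1 R ∩ q.1) q.2.2) (F₀, x₀, r) := by
  obtain ⟨t, ht, hcov⟩ := exists_card_eq_coverNumber_of_totallyBounded
    (F₀.isCompact.inter_left (isClosed_closedBall (x := x₀) (ε := R))).totallyBounded hr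
  -- A minimal cover persists: being far from the centre or inside the cover is an open condition.
  have hpersist : ∀ᶠ q : NonemptyCompacts X × X × ℝ in 𝓝 (F₀, x₀, r),
      ∀ y ∈ q.1, R < dist y q.2.1 ∨ ∃ c ∈ t, dist y c < q.2.2 := by
    refine eventually_forall_mem_nonemptyCompacts
      (p := fun y (z : X × ℝ) => R < dist y z.1 ∨ ∃ c ∈ t, dist y c < z.2) fun y hy => ?_
    rcases lt_or_ge R (dist y x₀) with hfar | hnear
    · have hopen : IsOpen {q : X × X × ℝ | R < dist q.1 q.2.1} :=
        isOpen_lt continuous_const (by fun_prop)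
      exact (hopen.eventually_mem hfar).mono fun q => .inl
    · obtain ⟨c, hc, hyc⟩ := Set.mem_iUnion₂.1 (hcov ⟨hnear, hy⟩)
      have hopen : IsOpen {q : X × X × ℝ | dist q.1 c < q.2.2} :=
        isOpen_lt (by fun_prop) (by fun_prop)
      exact (hopen.eventually_mem hyc).mono fun q hq => .inr ⟨c, hc, hq⟩
  intro m hm
  filter_upwards [hpersist] with q hq
  refine (coverNumber_le_card fun y hy => ?_).trans_lt (ht.trans_lt hm)
  simpa using (hq y hy.2).resolve_left (not_lt.2 hy.1)

end CoverNumber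

section ScaleRatio

variable {R θ : ℝ}

theorem div_rpow_eq_rpow (hR : 0 < R) : R / R ^ (1 / θ) = R ^ (1 - 1 / θ) := by
  rw [Real.rpow_sub hR, Real.rpow_one]

theorem one_sub_one_div_neg (hθ : θ ∈ Set.Ioo (0 : ℝ) 1) : 1 - 1 / θ < 0 :=
  sub_neg.2 ((one_lt_div hθ.1).2 hθ.2)

theorem one_le_div_rpow (hR : 0 < R) (hR1 : R ≤ 1) (hθ : θ ∈ Set.Ioo (0 : ℝ) 1) :
    1 ≤ R / R ^ (1 / θ) := by
  rw [div_rpow_eq_rpow hR]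
  exact Real.one_le_rpow_of_pos_of_le_one_of_nonpos hR hR1 (one_sub_one_div_neg hθ).le

theorem tendsto_div_rpow_atTop (hθ : θ ∈ Set.Ioo (0 : ℝ) 1) :
    Tendsto (fun R : ℝ => R / R ^ (1 / θ)) (𝓝[>] 0) atTop :=
  (tendsto_rpow_neg_nhdsGT_zero (one_sub_one_div_neg hθ)).congr' <|
    eventually_mem_nhdsWithin.mono fun _ hR => (div_rpow_eq_rpow hR).symm

theorem rpow_one_div_rpow_neg (hR : 0 < R) (hθ : θ ∈ Set.Ioo (0 : ℝ) 1) (s : ℝ) :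
    (R ^ (1 / θ)) ^ (-s) = (R / R ^ (1 / θ)) ^ (s / (1 - θ)) := by
  have hθ0 : θ ≠ 0 := hθ.1.ne'
  have hθ1 : 1 - θ ≠ 0 := (sub_pos.2 hθ.2).ne'
  rw [div_rpow_eq_rpow hR, ← Real.rpow_mul hR.le, ← Real.rpow_mul hR.le]
  congr 1
  field_simp
  ring

theorem tendsto_rpow_one_div_nhdsGT_zero (hθ : 0 < θ) :
    Tendsto (fun R : ℝ => R ^ (1 / θ)) (𝓝[>] 0) (𝓝[>] 0) := by
  refine tendsto_nhdsWithin_iff.2 ⟨?_, eventually_mem_nhdsWithin.mono fun R hR =>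
    Real.rpow_pos_of_pos hR _⟩
  have hcont : ContinuousAt (fun R : ℝ => R ^ (1 / θ)) 0 :=
    Real.continuousAt_rpow_const _ _ (.inr (one_div_pos.2 hθ).le)
  simpa [Real.zero_rpow, hθ.ne'] using hcont.tendsto.mono_left nhdsWithin_le_nhds

end ScaleRatio

section ExponentsUpTo

variable {X : Type*} [MetricSpace X] {F : Set X} {θ ρ α β : ℝ}

/-- The exponents satisfying the condition of `lowerSpectrumExponents` with the constant `C = 1`
and the threshold `ρ`. Fixing both constants turns admissibility of an exponent into a closed
condition on `(F, θ)`. -/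
def exponentsUpTo (F : Set X) (θ ρ : ℝ) : Set ℝ :=
  {α : ℝ | ∀ R : ℝ, 0 < R → R ≤ ρ → ∀ x ∈ F,
    (R / R ^ (1 / θ)) ^ α ≤ (coverNumber (closedBall x R ∩ F) (R ^ (1 / θ)) : ℝ)}

theorem isLowerSet_exponentsUpTo (hθ : θ ∈ Set.Ioo (0 : ℝ) 1) (hρ : ρ ≤ 1) :
    IsLowerSet (exponentsUpTo F θ ρ) := fun _ _ hβα hα R hR hRρ x hx =>
  (Real.rpow_le_rpow_of_exponent_le (one_le_div_rpow hR (hRρ.trans hρ) hθ) hβα).trans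
    (hα R hR hRρ x hx)

theorem exponentsUpTo_anti : Antitone (exponentsUpTo F θ) := fun _ _ hρ _ hα R hR hRρ =>
  hα R hR (hRρ.trans hρ)

theorem exponentsUpTo_subset_lowerSpectrumExponents (hρ : 0 < ρ) :
    exponentsUpTo F θ ρ ⊆ lowerSpectrumExponents F θ := fun _ hα =>
  ⟨1, one_pos, ρ, hρ, fun R hR hRρ x hx => by simpa only [one_mul] using hα R hR hRρ x hx⟩

theorem zero_mem_exponentsUpTo (hF : TotallyBounded F) : 0 ∈ exponentsUpTo F θ ρ :=
  fun R hR _ x hx => by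
    rw [Real.rpow_zero]
    exact_mod_cast one_le_coverNumber (hF.subset Set.inter_subset_right)
      ⟨x, mem_closedBall_self hR.le, hx⟩ (Real.rpow_pos_of_pos hR _)

-- Since `R / R ^ (1 / θ) → ∞` as `R → 0`, lowering the exponent absorbs the constant `C`.
theorem exists_mem_exponentsUpTo (hθ : θ ∈ Set.Ioo (0 : ℝ) 1)
    (hα : α ∈ lowerSpectrumExponents F θ) (hβ : β < α) : ∃ ρ > 0, β ∈ exponentsUpTo F θ ρ := by
  obtain ⟨C, hC, ρ, hρ, hbound⟩ := hα
  have hlim : Tendsto (fun R : ℝ => C * (R / R ^ (1 / θ)) ^ (α - β)) (𝓝[>] 0) atTop :=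
    ((tendsto_rpow_atTop (sub_pos.2 hβ)).comp (tendsto_div_rpow_atTop hθ)).const_mul_atTop hC
  obtain ⟨ρ', hρ', habsorb⟩ := mem_nhdsGT_iff_exists_Ioc_subset.1 (hlim.eventually_ge_atTop 1)
  refine ⟨min ρ ρ', lt_min hρ hρ', fun R hR hRρ x hx => ?_⟩
  have hratio : 0 < R / R ^ (1 / θ) := div_pos hR (Real.rpow_pos_of_pos hR _)
  calc (R / R ^ (1 / θ)) ^ β
      ≤ C * (R / R ^ (1 / θ)) ^ (α - β) * (R / R ^ (1 / θ)) ^ β :=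
        le_mul_of_one_le_left (Real.rpow_nonneg hratio.le _)
          (habsorb ⟨hR, hRρ.trans (min_le_right _ _)⟩)
    _ = C * (R / R ^ (1 / θ)) ^ α := by
        rw [mul_assoc, ← Real.rpow_add hratio, sub_add_cancel]
    _ ≤ coverNumber (closedBall x R ∩ F) (R ^ (1 / θ)) :=
        hbound R hR (hRρ.trans (min_le_left _ _)) x hx

theorem isClosed_setOf_mem_exponentsUpTo (ρ α : ℝ) :
    IsClosed {p : NonemptyCompacts X × Set.Ioo (0 : ℝ) 1 |
      α ∈ exponentsUpTo (p.1 : Set X) p.2 ρ} := by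
  refine isOpen_compl_iff.1 (isOpen_iff_eventually.2 ?_)
  rintro ⟨F₀, θ₀⟩ hα
  simp only [exponentsUpTo, Set.mem_compl_iff, Set.mem_ofPred_eq, not_forall, not_le] at hα
  obtain ⟨R, hR, hRρ, x₀, hx₀, hlt⟩ := hα
  have hpos (θ : ℝ) : 0 < R ^ (1 / θ) := Real.rpow_pos_of_pos hR _
  have hscale : Continuous fun q : NonemptyCompacts X × X × Set.Ioo (0 : ℝ) 1 =>
      R ^ (1 / (q.2.2 : ℝ)) :=
    continuous_const.rpow (continuous_const.div (by fun_prop) fun q => q.2.2.2.1.ne')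
      fun _ => .inl hR.ne'
  have hratio : Continuous fun q : NonemptyCompacts X × X × Set.Ioo (0 : ℝ) 1 =>
      (R / R ^ (1 / (q.2.2 : ℝ))) ^ α :=
    (continuous_const.div hscale fun _ => (hpos _).ne').rpow_const
      fun _ => .inl (div_pos hR (hpos _)).ne'
  have hcover := (continuous_fst.prodMk (continuous_snd.fst.prodMk hscale)).tendsto (F₀, x₀, θ₀)
    |>.eventually (upperSemicontinuousAt_coverNumber F₀ x₀ R (hpos θ₀) _ (Nat.lt_succ_self _))
  have hlarge := hratio.continuousAt (x := (F₀, x₀, θ₀)) |>.eventually_const_lt hlt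
  have hviolate : ∀ᶠ q : NonemptyCompacts X × X × Set.Ioo (0 : ℝ) 1 in 𝓝 (F₀, x₀, θ₀),
      (coverNumber (closedBall q.2.1 R ∩ q.1) (R ^ (1 / (q.2.2 : ℝ))) : ℝ)
        < (R / R ^ (1 / (q.2.2 : ℝ))) ^ α := by
    filter_upwards [hcover, hlarge] with q hq hlt
    exact hlt.trans_le' (Nat.cast_le.2 (Nat.lt_succ_iff.1 hq))
  filter_upwards [eventually_exists_mem_nonemptyCompacts (p := fun F x (θ : Set.Ioo (0 : ℝ) 1) =>
    (coverNumber (closedBall x R ∩ F) (R ^ (1 / (θ : ℝ))) : ℝ) < (R / R ^ (1 / (θ : ℝ))) ^ α)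
    hx₀ hviolate] with p ⟨x, hx, hlt⟩ hα
  exact (hα R hR hRρ x hx).not_gt hlt

end ExponentsUpTo

section LowerSpectrumApprox

variable {X : Type*} [MetricSpace X]

/-- The largest exponent in `[0, n]` admissible with constant `1` at all scales up to
`1 / (n + 1)`. These are bounded upper semicontinuous approximations of the lower spectrum. -/
noncomputable def lowerSpectrumApprox (X : Type*) [MetricSpace X] (n : ℕ)
    (p : NonemptyCompacts X × Set.Ioo (0 : ℝ) 1) : ℝ :=
  sSup (exponentsUpTo (p.1 : Set X) p.2 (1 / (n + 1)) ∩ Set.Icc 0 n)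

variable {n : ℕ} {p : NonemptyCompacts X × Set.Ioo (0 : ℝ) 1} {α : ℝ}

theorem le_lowerSpectrumApprox (hα : α ∈ exponentsUpTo (p.1 : Set X) p.2 (1 / (n + 1)))
    (hα0 : 0 ≤ α) (hαn : α ≤ n) : α ≤ lowerSpectrumApprox X n p :=
  le_csSup ⟨n, fun _ hβ => hβ.2.2⟩ ⟨hα, hα0, hαn⟩

theorem lowerSpectrumApprox_nonneg : 0 ≤ lowerSpectrumApprox X n p :=
  Real.sSup_nonneg fun _ hα => hα.2.1

theorem lowerSpectrumApprox_le : lowerSpectrumApprox X n p ≤ n :=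
  Real.sSup_le (fun _ hα => hα.2.2) n.cast_nonneg

theorem mem_exponentsUpTo_of_lt_lowerSpectrumApprox (hα : α < lowerSpectrumApprox X n p) :
    α ∈ exponentsUpTo (p.1 : Set X) p.2 (1 / (n + 1)) := by
  have hne : (exponentsUpTo (p.1 : Set X) p.2 (1 / (n + 1)) ∩ Set.Icc 0 n).Nonempty :=
    ⟨0, zero_mem_exponentsUpTo p.1.isCompact.totallyBounded, le_rfl, n.cast_nonneg⟩
  obtain ⟨β, hβ, hαβ⟩ := exists_lt_of_lt_csSup hne hα
  exact isLowerSet_exponentsUpTo p.2.2 ((div_le_one n.cast_add_one_pos).2 (by simp)) hαβ.le hβ.1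

theorem upperSemicontinuous_lowerSpectrumApprox :
    UpperSemicontinuous (lowerSpectrumApprox X n) := by
  intro p₀ c hc
  rcases lt_or_ge (n : ℝ) c with hnc | hcn
  · exact .of_forall fun p => lowerSpectrumApprox_le.trans_lt hnc
  obtain ⟨β, hβ, hβc⟩ := exists_between hc
  have hβ_notMem : β ∉ exponentsUpTo (p₀.1 : Set X) p₀.2 (1 / (n + 1)) := fun h =>
    hβ.not_ge (le_lowerSpectrumApprox h (lowerSpectrumApprox_nonneg.trans hβ.le)
      (hβc.le.trans hcn))
  filter_upwards [(isClosed_setOf_mem_exponentsUpTo _ β).isOpen_compl.mem_nhds hβ_notMem]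
    with p hp
  exact (le_of_not_gt fun h => hp (mem_exponentsUpTo_of_lt_lowerSpectrumApprox h)).trans_lt hβc

theorem isBaireClass_one_lowerSpectrumApprox : IsBaireClass 1 (lowerSpectrumApprox X n) :=
  isBaireClass_one_of_upperSemicontinuous upperSemicontinuous_lowerSpectrumApprox
    ⟨n, Set.forall_mem_range.2 fun _ => lowerSpectrumApprox_le⟩

theorem lowerSpectrumApprox_le_lowerSpectrumMap :
    (lowerSpectrumApprox X n p : EReal) ≤ lowerSpectrumMap X p :=
  EReal.ge_of_forall_gt_iff_ge.1 fun α hα => le_sSup <| Set.mem_image_of_mem _ <|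
    exponentsUpTo_subset_lowerSpectrumExponents (by positivity)
      (mem_exponentsUpTo_of_lt_lowerSpectrumApprox (EReal.coe_lt_coe_iff.1 hα))

theorem lowerSpectrumMap_nonneg : 0 ≤ lowerSpectrumMap X p :=
  (EReal.coe_nonneg.2 lowerSpectrumApprox_nonneg).trans
    (lowerSpectrumApprox_le_lowerSpectrumMap (n := 0))

theorem lowerSpectrumMap_ne_bot : lowerSpectrumMap X p ≠ ⊥ :=
  (EReal.bot_lt_zero.trans_le lowerSpectrumMap_nonneg).ne'

theorem tendsto_lowerSpectrumApprox (p : NonemptyCompacts X × Set.Ioo (0 : ℝ) 1) :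
    Tendsto (fun n => (lowerSpectrumApprox X n p : EReal)) atTop (𝓝 (lowerSpectrumMap X p)) := by
  refine tendsto_order.2 ⟨fun c hc => ?_, fun c hc => .of_forall fun n =>
    lowerSpectrumApprox_le_lowerSpectrumMap.trans_lt hc⟩
  obtain ⟨_, ⟨α, hα, rfl⟩, hcα⟩ := lt_sSup_iff.1 hc
  obtain ⟨β, hcβ, hβα⟩ := EReal.lt_iff_exists_real_btwn.1 hcα
  rcases lt_or_ge β 0 with hβ | hβ
  · exact .of_forall fun n => hcβ.trans
      (EReal.coe_lt_coe_iff.2 (hβ.trans_le lowerSpectrumApprox_nonneg))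
  obtain ⟨ρ, hρ, hβρ⟩ := exists_mem_exponentsUpTo p.2.2 hα (EReal.coe_lt_coe_iff.1 hβα)
  filter_upwards [tendsto_one_div_add_atTop_nhds_zero_nat.eventually_lt_const hρ,
    tendsto_natCast_atTop_atTop.eventually_ge_atTop β] with n hnρ hβn
  exact hcβ.trans_le (EReal.coe_le_coe_iff.2
    (le_lowerSpectrumApprox (exponentsUpTo_anti hnρ.le hβρ) hβ hβn))

theorem isBaireClass_two_lowerSpectrumMap : IsBaireClass 2 (lowerSpectrumMap X) :=
  ⟨fun n p => (lowerSpectrumApprox X n p : EReal),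
    fun _ => isBaireClass_one_lowerSpectrumApprox.continuous_comp continuous_coe_real_ereal,
    tendsto_lowerSpectrumApprox⟩

theorem isBaireClass_two_toReal_lowerSpectrumMap (h : ∀ p, lowerSpectrumMap X p ≠ ⊤) :
    IsBaireClass 2 fun p => (lowerSpectrumMap X p).toReal :=
  ⟨lowerSpectrumApprox X, fun _ => isBaireClass_one_lowerSpectrumApprox, fun p =>
    (EReal.tendsto_toReal (h p) lowerSpectrumMap_ne_bot).comp (tendsto_lowerSpectrumApprox p)⟩

end LowerSpectrumApprox

section UpperBound

theorem isLittleO_rpow_rpow_atTop {a b : ℝ} (hab : a < b) :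
    (fun x : ℝ => x ^ a) =o[atTop] fun x => x ^ b :=
  .of_tendsto_div_atTop <| (tendsto_rpow_atTop (sub_pos.2 hab)).congr' <|
    (eventually_gt_atTop 0).mono fun _ hx => Real.rpow_sub hx b a

variable {X : Type*} [MetricSpace X] {F : Set X} {θ s α : ℝ}

theorem isBigO_coverNumber_of_mem_lowerSpectrumExponents (hF : TotallyBounded F)
    (hne : F.Nonempty) (hα : α ∈ lowerSpectrumExponents F θ) :
    (fun R : ℝ => (R / R ^ (1 / θ)) ^ α)
      =O[𝓝[>] 0] fun R => (coverNumber F (R ^ (1 / θ)) : ℝ) := by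
  obtain ⟨x, hx⟩ := hne
  obtain ⟨C, hC, ρ, hρ, hbound⟩ := hα
  refine .of_bound C⁻¹ ?_
  filter_upwards [Ioc_mem_nhdsGT hρ] with R ⟨hR, hRρ⟩
  have hr : 0 < R ^ (1 / θ) := Real.rpow_pos_of_pos hR _
  have hmono : coverNumber (closedBall x R ∩ F) (R ^ (1 / θ)) ≤ coverNumber F (R ^ (1 / θ)) :=
    coverNumber_mono hF Set.inter_subset_right hr
  rw [Real.norm_of_nonneg (by positivity), Real.norm_natCast, le_inv_mul_iff₀ hC]
  exact (hbound R hR hRρ x hx).trans (Nat.cast_le.2 hmono)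

theorem lowerSpectrum_le_of_isBigO (hF : TotallyBounded F) (hne : F.Nonempty)
    (hθ : θ ∈ Set.Ioo (0 : ℝ) 1)
    (h : (fun r => (coverNumber F r : ℝ)) =O[𝓝[>] 0] fun r => r ^ (-s)) :
    lowerSpectrum F θ ≤ (s / (1 - θ) : ℝ) := by
  refine sSup_le ?_
  rintro _ ⟨α, hα, rfl⟩
  refine EReal.coe_le_coe_iff.2 (le_of_not_gt fun hsα => ?_)
  have hcover : (fun R : ℝ => (coverNumber F (R ^ (1 / θ)) : ℝ))
      =O[𝓝[>] 0] fun R => (R / R ^ (1 / θ)) ^ (s / (1 - θ)) :=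
    (h.comp_tendsto (tendsto_rpow_one_div_nhdsGT_zero hθ.1)).congr' .rfl <|
      eventually_mem_nhdsWithin.mono fun R hR => rpow_one_div_rpow_neg hR hθ s
  have hlower : (fun R : ℝ => (R / R ^ (1 / θ)) ^ (s / (1 - θ)))
      =o[𝓝[>] 0] fun R => (R / R ^ (1 / θ)) ^ α :=
    (isLittleO_rpow_rpow_atTop hsα).comp_tendsto (tendsto_div_rpow_atTop hθ)
  have hself := ((isBigO_coverNumber_of_mem_lowerSpectrumExponents hF hne hα).trans
    hcover).trans_isLittleO hlower
  refine isLittleO_irrefl (Eventually.frequently ?_) hself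
  filter_upwards [self_mem_nhdsWithin] with R hR
  exact (Real.rpow_pos_of_pos (div_pos hR (Real.rpow_pos_of_pos hR _)) _).ne'

theorem lowerSpectrum_le_zero_of_finite (hF : F.Finite) (hne : F.Nonempty)
    (hθ : θ ∈ Set.Ioo (0 : ℝ) 1) : lowerSpectrum F θ ≤ 0 := by
  have hbound : (fun r => (coverNumber F r : ℝ)) =O[𝓝[>] 0] fun r => r ^ (-0 : ℝ) := by
    refine .of_bound hF.toFinset.card (eventually_mem_nhdsWithin.mono fun r hr => ?_)
    have hcov : F ⊆ ⋃ c ∈ hF.toFinset, ball c r := fun x hx =>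
      Set.mem_iUnion₂.2 ⟨x, hF.mem_toFinset.2 hx, mem_ball_self hr⟩
    simpa using coverNumber_le_card hcov
  simpa using lowerSpectrum_le_of_isBigO hF.totallyBounded hne hθ hbound

end UpperBound

section Continua

variable {X : Type*} [MetricSpace X] {F G K : Set X} {x : X} {R θ : ℝ}

theorem Icc_subset_image_dist_of_isPreconnected (hK : IsPreconnected K) (hx : x ∈ K) {w : X}
    (hw : w ∈ K) (hR : R ≤ dist w x) : Set.Icc 0 R ⊆ (dist · x) '' (closedBall x R ∩ K) := by
  rintro s ⟨hs0, hsR⟩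
  obtain ⟨y, hy, rfl⟩ := hK.intermediate_value hx hw (f := (dist · x)) (by fun_prop)
    ⟨(dist_self x).trans_le hs0, hsR.trans hR⟩
  exact ⟨y, ⟨hsR, hy⟩, rfl⟩

theorem one_mem_lowerSpectrumExponents_of_isPreconnected (hK : IsPreconnected K)
    (hKb : TotallyBounded K) (hKn : K.Nontrivial) : 1 ∈ lowerSpectrumExponents K θ := by
  obtain ⟨u, hu, v, hv, huv⟩ := hKn
  refine ⟨1 / 2, by norm_num, dist u v / 2, half_pos (dist_pos.2 huv), fun R hR hRρ x hx => ?_⟩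
  obtain ⟨w, hw, hRw⟩ : ∃ w ∈ K, R ≤ dist w x := by
    by_contra! hnear
    linarith [hnear u hu, hnear v hv, dist_triangle_right u v x]
  have hr : 0 < R ^ (1 / θ) := Real.rpow_pos_of_pos hR _
  have hlength : R ≤ coverNumber (closedBall x R ∩ K) (R ^ (1 / θ)) * (2 * R ^ (1 / θ)) := by
    refine (ENNReal.ofReal_le_ofReal_iff (by positivity)).1 ?_
    calc ENNReal.ofReal R = MeasureTheory.volume (Set.Icc 0 R) := by simp
      _ ≤ MeasureTheory.volume ((dist · x) '' (closedBall x R ∩ K)) :=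
          MeasureTheory.measure_mono (Icc_subset_image_dist_of_isPreconnected hK hx hw hRw)
      _ ≤ coverNumber (closedBall x R ∩ K) (R ^ (1 / θ)) * ENNReal.ofReal (2 * R ^ (1 / θ)) :=
          volume_image_le_coverNumber_mul (.dist_left x) (hKb.subset Set.inter_subset_right) hr
      _ = _ := by rw [ENNReal.ofReal_mul (Nat.cast_nonneg _), ENNReal.ofReal_natCast]
  rw [Real.rpow_one, ← mul_div_assoc, div_le_iff₀ hr]
  linarith

theorem inter_lowerSpectrumExponents_subset_union (hF : TotallyBounded F)
    (hG : TotallyBounded G) :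
    lowerSpectrumExponents F θ ∩ lowerSpectrumExponents G θ
      ⊆ lowerSpectrumExponents (F ∪ G) θ := by
  rintro α ⟨⟨C, hC, ρ, hρ, hFα⟩, C', hC', ρ', hρ', hGα⟩
  refine ⟨min C C', lt_min hC hC', min ρ ρ', lt_min hρ hρ', fun R hR hRρ x hx => ?_⟩
  have hr : 0 < R ^ (1 / θ) := Real.rpow_pos_of_pos hR _
  have hmono {E : Set X} (hE : E ⊆ F ∪ G) : (coverNumber (closedBall x R ∩ E) (R ^ (1 / θ)) : ℝ)
      ≤ coverNumber (closedBall x R ∩ (F ∪ G)) (R ^ (1 / θ)) :=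
    Nat.cast_le.2 (coverNumber_mono ((hF.union hG).subset Set.inter_subset_right)
      (Set.inter_subset_inter_right _ hE) hr)
  rcases hx with hx | hx
  · calc min C C' * (R / R ^ (1 / θ)) ^ α ≤ C * (R / R ^ (1 / θ)) ^ α := by
          gcongr
          exact min_le_left _ _
      _ ≤ _ := (hFα R hR (hRρ.trans (min_le_left _ _)) x hx).trans (hmono Set.subset_union_left)
  · calc min C C' * (R / R ^ (1 / θ)) ^ α ≤ C' * (R / R ^ (1 / θ)) ^ α := by
          gcongr
          exact min_le_right _ _
      _ ≤ _ := (hGα R hR (hRρ.trans (min_le_right _ _)) x hx).trans (hmono Set.subset_union_right)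

theorem supClosed_setOf_mem_lowerSpectrumExponents (θ α : ℝ) :
    SupClosed {F : NonemptyCompacts X | α ∈ lowerSpectrumExponents (F : Set X) θ} :=
  fun F hF G hG => inter_lowerSpectrumExponents_subset_union F.isCompact.totallyBounded
    G.isCompact.totallyBounded ⟨hF, hG⟩

theorem exists_continuum_subset_of_mem_nhds {Y : Type*} [TopologicalSpace Y] [T2Space Y]
    [LocallyCompactSpace Y] [LocallyConnectedSpace Y] [PerfectSpace Y] {y : Y} {U : Set Y}
    (hU : U ∈ 𝓝 y) : ∃ K ⊆ U, IsCompact K ∧ IsPreconnected K ∧ K.Nontrivial := by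
  obtain ⟨L, hL, hLU, hLc⟩ := local_compact_nhds hU
  obtain ⟨V, hVL, hVo, hyV, hV⟩ :=
    locallyConnectedSpace_iff_subsets_isOpen_isConnected.1 inferInstance y L hL
  have hVL' : closure V ⊆ L := closure_minimal hVL hLc.isClosed
  exact ⟨closure V, hVL'.trans hLU, hLc.of_isClosed_subset isClosed_closure hVL',
    hV.isPreconnected.closure,
    (infinite_of_mem_nhds y (hVo.mem_nhds hyV)).nontrivial.mono subset_closure⟩

variable [LocallyCompactSpace X] [LocallyConnectedSpace X] [PerfectSpace X]

theorem dense_setOf_one_mem_lowerSpectrumExponents (θ : ℝ) :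
    Dense {F : NonemptyCompacts X | 1 ∈ lowerSpectrumExponents (F : Set X) θ} := by
  refine dense_of_supClosed_of_singleton_mem_closure
    (supClosed_setOf_mem_lowerSpectrumExponents θ 1) fun x => ?_
  refine Metric.mem_closure_iff.2 fun ε hε => ?_
  obtain ⟨K, hKε, hKc, hKp, hKn⟩ :=
    exists_continuum_subset_of_mem_nhds (closedBall_mem_nhds x (half_pos hε))
  refine ⟨⟨⟨K, hKc⟩, hKn.nonempty⟩,
    one_mem_lowerSpectrumExponents_of_isPreconnected hKp hKc.totallyBounded hKn, ?_⟩
  obtain ⟨y, hy⟩ := hKn.nonempty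
  rw [NonemptyCompacts.dist_eq]
  refine (hausdorffDist_le_of_mem_dist (half_pos hε).le ?_ fun z hz => ?_).trans_lt
    (half_lt_self hε)
  · rintro _ rfl
    exact ⟨y, hy, dist_comm y _ ▸ hKε hy⟩
  · exact ⟨x, rfl, hKε hz⟩

theorem not_isBaireClass_one_lowerSpectrumMap [Nonempty X] :
    ¬ IsBaireClass 1 (lowerSpectrumMap X) := by
  intro h
  let θ : Set.Ioo (0 : ℝ) 1 := ⟨1 / 2, by norm_num⟩
  have hslice : IsBaireClass 1 fun F : NonemptyCompacts X => lowerSpectrumMap X (F, θ) :=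
    h.comp_continuous (φ := fun F => (F, θ)) (by fun_prop)
  obtain ⟨c, hc0, hc1⟩ := exists_between (zero_lt_one (α := EReal))
  obtain ⟨d, hcd, hd1⟩ := exists_between hc1
  refine not_isBaireClass_one_of_dense hcd ?_ ?_ hslice
  · exact NonemptyCompacts.dense_setOfPred_finite.mono fun F hF =>
      (lowerSpectrum_le_zero_of_finite hF F.nonempty θ.2).trans_lt hc0
  · exact (dense_setOf_one_mem_lowerSpectrumExponents (θ : ℝ)).mono fun F hF =>
      hd1.trans_le (le_sSup ⟨1, hF, EReal.coe_one⟩)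

theorem not_isBaireClass_one_toReal_lowerSpectrumMap [Nonempty X]
    (h : ∀ p, lowerSpectrumMap X p ≠ ⊤) :
    ¬ IsBaireClass 1 fun p => (lowerSpectrumMap X p).toReal := fun hreal =>
  not_isBaireClass_one_lowerSpectrumMap (X := X) <| by
    simpa only [EReal.coe_toReal (h _) lowerSpectrumMap_ne_bot]
      using hreal.continuous_comp continuous_coe_real_ereal

end Continua

section UnitInterval

theorem coverNumber_unitInterval_le (E : Set unitInterval) {r : ℝ} (hr : 0 < r) :
    coverNumber E r ≤ ⌊1 / r⌋₊ + 1 := by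
  let centre (i : ℕ) : unitInterval := Set.projIcc 0 1 zero_le_one (i * r)
  have hcov : E ⊆ ⋃ c ∈ (Finset.range (⌊1 / r⌋₊ + 1)).image centre, ball c r := fun x _ => by
    set i := ⌊(x : ℝ) / r⌋₊
    have hi : i ≤ ⌊1 / r⌋₊ := Nat.floor_mono (by gcongr; exact x.2.2)
    have hix : (i : ℝ) * r ≤ x := (le_div_iff₀ hr).1 (Nat.floor_le (div_nonneg x.2.1 hr.le))
    have hxi : (x : ℝ) < (i + 1) * r := (div_lt_iff₀ hr).1 (Nat.lt_floor_add_one _)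
    have hcentre : (centre i : ℝ) = i * r :=
      congrArg Subtype.val (Set.projIcc_of_mem zero_le_one ⟨by positivity, hix.trans x.2.2⟩)
    refine Set.mem_iUnion₂.2
      ⟨centre i, Finset.mem_image_of_mem _ (Finset.mem_range_succ_iff.2 hi), ?_⟩
    rw [mem_ball, Subtype.dist_eq, hcentre, Real.dist_eq, abs_of_nonneg (sub_nonneg.2 hix)]
    linarith
  exact (coverNumber_le_card hcov).trans (Finset.card_image_le.trans (Finset.card_range _).le)

theorem isBigO_coverNumber_unitInterval (E : Set unitInterval) :
    (fun r => (coverNumber E r : ℝ)) =O[𝓝[>] 0] fun r => r ^ (-1 : ℝ) := by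
  refine .of_bound 2 ?_
  filter_upwards [Ioc_mem_nhdsGT one_pos] with r ⟨hr, hr1⟩
  rw [Real.norm_natCast, Real.rpow_neg_one, Real.norm_of_nonneg (by positivity)]
  calc (coverNumber E r : ℝ) ≤ ⌊1 / r⌋₊ + 1 := mod_cast coverNumber_unitInterval_le E hr
    _ ≤ r⁻¹ + r⁻¹ := by
        rw [one_div]
        exact add_le_add (Nat.floor_le (by positivity)) ((one_le_inv₀ hr).2 hr1)
    _ = 2 * r⁻¹ := (two_mul _).symm

theorem lowerSpectrumMap_unitInterval_ne_top
    (p : NonemptyCompacts unitInterval × Set.Ioo (0 : ℝ) 1) :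
    lowerSpectrumMap unitInterval p ≠ ⊤ :=
  ((lowerSpectrum_le_of_isBigO p.1.isCompact.totallyBounded p.1.nonempty p.2.2
    (isBigO_coverNumber_unitInterval _)).trans_lt (EReal.coe_lt_top _)).ne

instance locallyConnectedSpace_unitInterval : LocallyConnectedSpace unitInterval :=
  (isQuotientMap_projIcc (h := zero_le_one (α := ℝ))).isCoinducing.locallyConnectedSpace

end UnitInterval

theorem theorem5p2_general (X : Type*) [MetricSpace X] :
    (IsBaireClass 2 (lowerSpectrumMap X) ∧
      @Measurable _ _ (borel (NonemptyCompacts X × Set.Ioo (0 : ℝ) 1)) (borel EReal)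
        (lowerSpectrumMap X) ∧
      ((∀ p, lowerSpectrumMap X p ≠ ⊤) →
        IsBaireClass 2 (fun p => (lowerSpectrumMap X p).toReal))) ∧
    (∀ [LocallyCompactSpace X] [LocallyConnectedSpace X] [PerfectSpace X] [Nonempty X],
      ¬ IsBaireClass 1 (lowerSpectrumMap X) ∧
      ((∀ p, lowerSpectrumMap X p ≠ ⊤) →
        ¬ IsBaireClass 1 (fun p => (lowerSpectrumMap X p).toReal))) := by
  refine ⟨⟨isBaireClass_two_lowerSpectrumMap, ?_, isBaireClass_two_toReal_lowerSpectrumMap⟩,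
    not_isBaireClass_one_lowerSpectrumMap, not_isBaireClass_one_toReal_lowerSpectrumMap⟩
  borelize (NonemptyCompacts X × Set.Ioo (0 : ℝ) 1)
  exact isBaireClass_two_lowerSpectrumMap.measurable

theorem theorem5p2 :
    (∀ (X : Type*) [MetricSpace X] [CompactSpace X] [Nonempty X],
      IsBaireClass 2 (lowerSpectrumMap X) ∧
      @Measurable _ _ (borel (NonemptyCompacts X × Set.Ioo (0 : ℝ) 1)) (borel EReal)
        (lowerSpectrumMap X) ∧
      ((∀ p, lowerSpectrumMap X p ≠ ⊤) →
        IsBaireClass 2 (fun p => (lowerSpectrumMap X p).toReal))) ∧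
    ((∀ p, lowerSpectrumMap unitInterval p ≠ ⊤) ∧
      ¬ IsBaireClass 1 (lowerSpectrumMap unitInterval) ∧
      ¬ IsBaireClass 1 (fun p => (lowerSpectrumMap unitInterval p).toReal)) :=
  ⟨fun X _ _ _ => (theorem5p2_general X).1, lowerSpectrumMap_unitInterval_ne_top,
    (theorem5p2_general unitInterval).2.imp_right (· lowerSpectrumMap_unitInterval_ne_top)⟩
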